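/- Let $\mathscr A$ be a totally ordered alphabet and let $w=w_1w_2\cdots w_n$ be a word over $\mathscr A$. Let $R(w)$ be its rearrangement class, i.e. the set of all words obtained by permuting the letters of $w$. For a word $v=v_1\cdots v_n$ over $\mathscr A$, let $c(v)\in\mathcal S_n$ be the permutation determined by: $c(v)_i<c(v)_j$ if and only if $v_i<v_j$, or $v_i=v_j$ and $i<j$. Put $$D(v)=\{i: 1\le i<n,\ v_i>v_{i+1}\},\qquad Id(v)=\{c(v)_i:\ \exists\, j<i\ \text{with}\ c(v)_j=c(v)_i+1\},$$ $$\mathrm{des}\,v=|D(v)|,\qquad \mathrm F\,v=v_1,\qquad \mathrm{MAJ}\,v=\sum_{i\in D(v)} i,$$ $$\mathrm{STAT}\,v=(\underline{21}3+\underline{21}2+\underline{13}2+\underline{12}1+\underline{32}1+\underline{21})\,v,$$ where $(\tau)v$ denotes the number of occurrences of the vincular pattern $\tau$ in $v$: the number of subsequences of $v$ (counted by their positions) that are order-isomorphic to $\tau$, equalities between letters included, and whose letters matching the underlined letters of $\tau$ are adjacent in $v$. (For the empty word, $\mathrm F$ takes a fixed dummy value.) Then the statistics $(\mathrm{des}, Id,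 \mathrm F,\mathrm{MAJ},\mathrm{STAT})$ and $(\mathrm{des}, Id, \mathrm F,\mathrm{STAT},\mathrm{MAJ})$ have the same joint distribution on $R(w)$: for every possible value $x$ of these quintuples, the number of $v\in R(w)$ at which the first quintuple equals $x$ is the same as the number of $v\in R(w)$ at which the second equals $x$. -/

import Mathlib

/-!
Words of length `n` over a totally ordered alphabet `α` are functions `w : Fin n → α`.
Lean indexes the letters by `0, …, n - 1`; the sets of positions and of values below are
shifted so that, as usual, they are subsets of `{1, …, n}`.
-/

namespace WordStat

variable {α : Type*} [LinearOrder α] {n : ℕ}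

/-- The rearrangement class `R(w)`: all distinct words obtained by permuting the letters
of `w`. -/
def rearrangementClass (w : Fin n → α) : Finset (Fin n → α) :=
  Finset.univ.image fun σ : Equiv.Perm (Fin n) => w ∘ σ

/-- The coding map: `coding w` is the permutation `c` with `c i < c j` if and only if
`w i < w j`, or `w i = w j` and `i < j`; see `coding_lt_iff` and `eq_coding`. -/
def coding (w : Fin n → α) : Equiv.Perm (Fin n) :=
  (Tuple.sort w)⁻¹

theorem coding_lt_iff (w : Fin n → α) (i j : Fin n) :
    coding w i < coding w j ↔ w i < w j ∨ (w i = w j ∧ i < j) := by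
  have h : StrictMono ((Tuple.sort w).trans (Tuple.graphEquiv₁ w)) :=
    Tuple.eq_sort_iff'.1 rfl
  have key := h.lt_iff_lt (a := coding w i) (b := coding w j)
  simp only [coding, Equiv.Perm.inv_def, Equiv.trans_apply, Equiv.apply_symm_apply] at key
  rw [coding, Equiv.Perm.inv_def, ← key, ← Subtype.coe_lt_coe, Prod.Lex.lt_iff]
  rfl

theorem eq_coding (w : Fin n → α) (c : Equiv.Perm (Fin n))
    (hc : ∀ i j, c i < c j ↔ w i < w j ∨ (w i = w j ∧ i < j)) : c = coding w := by
  have hm : StrictMono (fun i => coding w (c.symm i)) := by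
    intro i j hij
    have := (hc (c.symm i) (c.symm j)).1 (by simpa using hij)
    exact (coding_lt_iff w _ _).2 this
  have hid : (fun i => coding w (c.symm i)) = id := by
    apply StrictMono.range_inj hm strictMono_id |>.1
    rw [Set.range_id]
    exact ((coding w).surjective.comp c.symm.surjective).range_eq
  ext i
  have := congrFun hid (c i)
  simp only [Equiv.symm_apply_apply, id] at this
  rw [this]

/-- The descent set `{i : w_i > w_{i+1}, 1 ≤ i < n}`. -/
def descentSet (w : Fin n → α) : Finset ℕ :=
  (Finset.univ.filter fun i : Fin n => ∃ j : Fin n, (j : ℕ) = i + 1 ∧ w j < w i).image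
    fun i : Fin n => (i : ℕ) + 1

/-- The inverse descent set `{c(w)_i : ∃ j < i, c(w)_j = c(w)_i + 1}`. -/
def inverseDescentSet (w : Fin n → α) : Finset ℕ :=
  (Finset.univ.filter fun i : Fin n =>
    ∃ j : Fin n, j < i ∧ (coding w j : ℕ) = coding w i + 1).image
    fun i : Fin n => (coding w i : ℕ) + 1

/-- The number of descents. -/
def des (w : Fin n → α) : ℕ := (descentSet w).card

/-- The first letter `w_1` (`none` for the empty word). -/
def firstLetter (w : Fin n → α) : Option α :=
  if h : 0 < n then some (w ⟨0, h⟩) else none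

/-- The major index: the sum of the descents. -/
def MAJ (w : Fin n → α) : ℕ := ∑ i ∈ descentSet w, i

/-- `e` selects an occurrence in `w` of the vincular pattern given by the word `p` of length
`k` and the set `A`: the subword of `w` at the increasing positions `e` is order-isomorphic
to `p`, and for each `i` in `A` its letters with (zero-based) indices `i` and `i + 1` are
adjacent in `w`. -/
def IsOccurrence {k : ℕ} (p : Fin k → ℕ) (A : Finset ℕ) (w : Fin n → α)
    (e : Fin k → Fin n) : Prop :=
  (∀ i j, i < j → e i < e j) ∧
  (∀ i j, w (e i) < w (e j) ↔ p i < p j) ∧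
  (∀ i j : Fin k, (i : ℕ) ∈ A → (j : ℕ) = i + 1 → (e j : ℕ) = e i + 1)

instance {k : ℕ} (p : Fin k → ℕ) (A : Finset ℕ) (w : Fin n → α) :
    DecidablePred (IsOccurrence p A w) := fun _ =>
  inferInstanceAs (Decidable (_ ∧ _ ∧ _))

/-- The number of occurrences in `w` of the vincular pattern `(p, A)`. -/
def occurrences {k : ℕ} (p : Fin k → ℕ) (A : Finset ℕ) (w : Fin n → α) : ℕ :=
  (Finset.univ.filter fun e : Fin k → Fin n => IsOccurrence p A w e).card

/-- The statistic STAT, the sum of the numbers of occurrences of the vincular patterns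
`213`, `212`, `132`, `121`, `321`, `21`, each with its first two letters underlined
(that is, required to be adjacent). -/
def STAT (w : Fin n → α) : ℕ :=
  occurrences ![2, 1, 3] {0} w + occurrences ![2, 1, 2] {0} w + occurrences ![1, 3, 2] {0} w +
    occurrences ![1, 2, 1] {0} w + occurrences ![3, 2, 1] {0} w + occurrences ![2, 1] {0} w

/-- `f` and `g` have the same (joint) distribution on the finite set `S`. -/
def EquidistributedOn {β γ : Type*} [DecidableEq γ] (S : Finset β) (f g : β → γ) : Prop :=
  ∀ c : γ, (S.filter fun x => f x = c).card = (S.filter fun x => g x = c).card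

end WordStat

/-! For words of length `n + 1` one has STAT + MAJ + #{j : v_j < v_1} = (n + 2) des
(`STAT_add_MAJ`). Every term is unchanged by `coding`, so on permutations with fixed first letter
`f`, fixed `d = des` and fixed inverse descent set, STAT is MAJ reflected by m ↦ (n + 2) d - f - m.
The theorem becomes the invariance of the distribution of MAJ under this reflection, written with
Laurent polynomials as P = T(c) * invert P.

The invariance comes from a P-partition argument. Functions `g` that decrease weakly on blocks and
have maximum `M`, first attained at `f`, are stable under a complementation (`blockGF_symm`).
Sorting `g` splits it into a permutation and a partition (`blockGF_eq_sum_majGF`), and induction on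
`M` transfers the symmetry to MAJ (`majGF_symm`). The block condition says that the inverse descent
set lies in a given set; Möbius inversion makes this an equality (`inverseDescentGF_symm`). The
resulting bijection of permutations preserves inverse descents, hence lifts to words
(`exists_swap`). -/

namespace WordStat

open Finset LaurentPolynomial

/-! ### The linear relation between STAT and MAJ, and invariance under coding. -/

section Statistics

variable {α : Type*} [LinearOrder α] {n : ℕ}

theorem descentSet_eq (v : Fin (n + 1) → α) :
    descentSet v = (univ.filter fun i : Fin n => v i.succ < v i.castSucc).image
      fun i : Fin n => (i : ℕ) + 1 := by
  ext t
  simp only [descentSet, mem_image, mem_filter, mem_univ, true_and]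
  constructor
  · rintro ⟨i, ⟨j, hj, hlt⟩, rfl⟩
    have hi : (i : ℕ) < n := by omega
    refine ⟨⟨i, hi⟩, ?_, rfl⟩
    have h1 : (⟨i, hi⟩ : Fin n).succ = j := Fin.ext (by simp [hj])
    have h2 : (⟨i, hi⟩ : Fin n).castSucc = i := Fin.ext (by simp)
    rwa [h1, h2]
  · rintro ⟨i, hi, rfl⟩
    exact ⟨i.castSucc, ⟨i.succ, by simp, hi⟩, by simp⟩

theorem des_eq (v : Fin (n + 1) → α) :
    des v = #{i : Fin n | v i.succ < v i.castSucc} := by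
  rw [des, descentSet_eq, card_image_of_injective]
  intro i j h
  simpa [Fin.ext_iff] using h

theorem MAJ_eq (v : Fin (n + 1) → α) :
    MAJ v = ∑ i : Fin n with v i.succ < v i.castSucc, ((i : ℕ) + 1) := by
  rw [MAJ, descentSet_eq, sum_image]
  intro i _ j _ h
  simpa [Fin.ext_iff] using h

theorem occurrences_two (v : Fin (n + 1) → α) : occurrences ![2, 1] {0} v = des v := by
  rw [des_eq, occurrences]
  symm
  refine card_nbij (fun i => ![i.castSucc, i.succ]) ?_ ?_ ?_
  · intro i hi
    simp only [coe_filter, mem_univ, true_and, Set.mem_ofPred_eq] at hi ⊢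
    refine ⟨?_, ?_, ?_⟩ <;> simp [Fin.forall_fin_two, hi, hi.le]
  · intro i _ j _ h
    simpa using congrFun h 1
  · intro e he
    simp only [coe_filter, mem_univ, true_and, Set.mem_ofPred_eq] at he
    obtain ⟨-, h2, h3⟩ := he
    have h3 := h3 0 1 (by simp) (by simp)
    have hi : ((e 0 : Fin (n + 1)) : ℕ) < n := by omega
    have ha : (⟨e 0, hi⟩ : Fin n).castSucc = e 0 := Fin.ext (by simp)
    have hb : (⟨e 0, hi⟩ : Fin n).succ = e 1 := Fin.ext (by simp [h3])
    refine ⟨⟨e 0, hi⟩, ?_, ?_⟩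
    · simpa [ha, hb] using h2 1 0
    · funext k
      fin_cases k
      · exact ha
      · exact hb

theorem occurrences_three (p : Fin 3 → ℕ) (v : Fin (n + 1) → α) :
    (occurrences p {0} v : ℤ) = ∑ c : Fin (n + 1), ∑ i : Fin n with i.succ < c,
      if ∀ k l : Fin 3, v (![i.castSucc, i.succ, c] k) < v (![i.castSucc, i.succ, c] l) ↔
        p k < p l then 1 else 0 := by
  have h : occurrences p {0} v = #{x : Fin (n + 1) × Fin n | x.2.succ < x.1 ∧
      ∀ k l : Fin 3, v (![x.2.castSucc, x.2.succ, x.1] k) < v (![x.2.castSucc, x.2.succ, x.1] l) ↔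
        p k < p l} := by
    rw [occurrences]
    symm
    refine card_nbij (fun x => ![x.2.castSucc, x.2.succ, x.1]) ?_ ?_ ?_
    · rintro ⟨c, i⟩ hi
      simp only [coe_filter, mem_univ, true_and, Set.mem_ofPred_eq] at hi ⊢
      refine ⟨?_, hi.2, ?_⟩
      · have h1 := hi.1
        have h2 : i.castSucc < i.succ := Fin.castSucc_lt_succ
        have h3 := h2.trans h1
        intro a b hab
        fin_cases a <;> fin_cases b <;> simp_all
      · intro a b ha hab
        simp only [mem_singleton] at ha
        have ha' : a = 0 := Fin.ext ha
        have hb' : b = 1 := Fin.ext (by simp [hab, ha])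
        subst ha' hb'
        simp
    · rintro ⟨c, i⟩ _ ⟨d, j⟩ _ h
      have h1 := congrFun h 1
      have h2 := congrFun h 2
      simp_all
    · intro e he
      simp only [coe_filter, mem_univ, true_and, Set.mem_ofPred_eq] at he
      obtain ⟨h1, h2, h3⟩ := he
      have h3 := h3 0 1 (by simp) (by simp)
      have hi : ((e 0 : Fin (n + 1)) : ℕ) < n := by omega
      have ha : (⟨e 0, hi⟩ : Fin n).castSucc = e 0 := Fin.ext (by simp)
      have hb : (⟨e 0, hi⟩ : Fin n).succ = e 1 := Fin.ext (by simp [h3])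
      have he : ![e 0, e 1, e 2] = e := by
        funext k
        fin_cases k <;> rfl
      refine ⟨(e 2, ⟨e 0, hi⟩), ?_, ?_⟩
      · simp only [coe_filter, mem_univ, true_and, Set.mem_ofPred_eq, ha, hb, he]
        exact ⟨h1 1 2 (by decide), h2⟩
      · simp only [ha, hb, he]
  rw [h, card_filter, ← univ_product_univ, sum_product]
  push_cast
  refine sum_congr rfl fun c _ => ?_
  rw [sum_filter]
  refine sum_congr rfl fun i _ => ?_
  simp only [ite_and]

/-- Checked on all relative orders of the three letters. In this form, for fixed `c`, the bracketed
difference telescopes along the adjacent pairs `a b`. -/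
theorem pattern_indicator (a b c : α) :
    ((if ∀ k l : Fin 3, ![a, b, c] k < ![a, b, c] l ↔
        (![2, 1, 3] : Fin 3 → ℕ) k < (![2, 1, 3] : Fin 3 → ℕ) l then 1 else 0) +
      (if ∀ k l : Fin 3, ![a, b, c] k < ![a, b, c] l ↔
        (![2, 1, 2] : Fin 3 → ℕ) k < (![2, 1, 2] : Fin 3 → ℕ) l then 1 else 0) +
      (if ∀ k l : Fin 3, ![a, b, c] k < ![a, b, c] l ↔
        (![1, 3, 2] : Fin 3 → ℕ) k < (![1, 3, 2] : Fin 3 → ℕ) l then 1 else 0) +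
      (if ∀ k l : Fin 3, ![a, b, c] k < ![a, b, c] l ↔
        (![1, 2, 1] : Fin 3 → ℕ) k < (![1, 2, 1] : Fin 3 → ℕ) l then 1 else 0) +
      (if ∀ k l : Fin 3, ![a, b, c] k < ![a, b, c] l ↔
        (![3, 2, 1] : Fin 3 → ℕ) k < (![3, 2, 1] : Fin 3 → ℕ) l then 1 else 0) : ℤ) =
    (if b < a then 1 else 0) + ((if c < b then 1 else 0) - (if c < a then 1 else 0)) := by
  simp only [Fin.forall_fin_succ, IsEmpty.forall_iff]
  rcases lt_trichotomy a b with h1 | h1 | h1 <;> rcases lt_trichotomy a c with h2 | h2 | h2 <;>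
    rcases lt_trichotomy b c with h3 | h3 | h3 <;>
    first
    | (exfalso; order)
    | simp_all [not_lt_of_gt]

theorem sum_telescope (h : Fin (n + 1) → ℤ) (j : Fin n) :
    ∑ i : Fin n with i.succ < j.succ, (h i.succ - h i.castSucc) = h j.castSucc - h 0 := by
  obtain ⟨j, hj⟩ := j
  induction j with
  | zero =>
    rw [sum_eq_zero]
    · have : (⟨0, hj⟩ : Fin n).castSucc = 0 := rfl
      simp [this]
    · simp [Fin.lt_def]
  | succ j ih =>
    have : (univ.filter fun i : Fin n => i.succ < (⟨j + 1, hj⟩ : Fin n).succ) =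
        insert ⟨j, by omega⟩
          (univ.filter fun i : Fin n => i.succ < (⟨j, by omega⟩ : Fin n).succ) := by
      ext i
      simp only [mem_filter, mem_univ, true_and, mem_insert, Fin.lt_def, Fin.val_succ,
        Fin.ext_iff]
      omega
    rw [this, sum_insert (by simp), ih (by omega)]
    have e : (⟨j, by omega⟩ : Fin n).succ = (⟨j + 1, hj⟩ : Fin n).castSucc := rfl
    rw [e]
    ring

/-- STAT is determined by MAJ, the number of descents and the rank of the first letter. -/
theorem STAT_add_MAJ (v : Fin (n + 1) → α) :
    STAT v + MAJ v + #{j | v j < v 0} = (n + 2) * des v := by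
  have hv : ∀ (i : Fin n) (c : Fin (n + 1)) (k : Fin 3), v (![i.castSucc, i.succ, c] k) =
      ![v i.castSucc, v i.succ, v c] k := by
    intro i c k
    fin_cases k <;> rfl
  have h : (STAT v : ℤ) = (∑ c : Fin (n + 1), ∑ i : Fin n with i.succ < c,
      ((if v i.succ < v i.castSucc then 1 else 0) +
        ((if v c < v i.succ then 1 else 0) - (if v c < v i.castSucc then 1 else 0)))) + des v := by
    rw [STAT, occurrences_two]
    push_cast
    simp only [occurrences_three, hv, ← sum_add_distrib, pattern_indicator]
  -- Telescoping leaves the comparisons of the last letter with its immediate predecessor, which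
  -- count descents, and with the first letter.
  have hj : ∀ j : Fin n, ∑ i : Fin n with i.succ < j.succ,
      (((if v i.succ < v i.castSucc then 1 else 0) +
        ((if v j.succ < v i.succ then 1 else 0) -
          (if v j.succ < v i.castSucc then 1 else 0))) : ℤ) =
      (∑ i : Fin n with i < j, (if v i.succ < v i.castSucc then 1 else 0)) +
      ((if v j.succ < v j.castSucc then 1 else 0) - (if v j.succ < v 0 then 1 else 0)) := by
    intro j
    rw [sum_add_distrib, sum_telescope (fun x => if v j.succ < v x then 1 else 0)]
    simp only [Fin.succ_lt_succ_iff]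
  -- A descent at zero-based index `i` is counted once for each of the `n - 1 - i` larger indices
  -- `j`.
  have hs : ∑ j : Fin n, ∑ i : Fin n with i < j,
      ((if v i.succ < v i.castSucc then 1 else 0) : ℤ) =
      ∑ i : Fin n, if v i.succ < v i.castSucc then (n : ℤ) - 1 - i else 0 := by
    simp only [sum_filter]
    rw [sum_comm]
    refine sum_congr rfl fun i _ => ?_
    rw [← sum_filter, sum_const]
    have : (univ.filter fun j : Fin n => i < j) = Ioi i := by ext; simp
    rw [this, Fin.card_Ioi]
    have := i.2
    split_ifs
    · simp only [nsmul_eq_mul]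
      omega
    · simp
  have hL : (#{j | v j < v 0} : ℤ) = ∑ j : Fin n, if v j.succ < v 0 then 1 else 0 := by
    rw [card_filter, Fin.sum_univ_succ (n := n)]
    simp
  have hd : (des v : ℤ) = ∑ i : Fin n, if v i.succ < v i.castSucc then 1 else 0 := by
    rw [des_eq, card_filter]
    simp
  have hM : (MAJ v : ℤ) = ∑ i : Fin n, if v i.succ < v i.castSucc then (i : ℤ) + 1 else 0 := by
    rw [MAJ_eq, sum_filter]
    push_cast
    rfl
  rw [Fin.sum_univ_succ] at h
  simp only [hj, sum_add_distrib, sum_sub_distrib, hs, Fin.not_lt_zero, filter_false,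
    sum_empty] at h
  zify
  have hA : (∑ i : Fin n, if v i.succ < v i.castSucc then (n : ℤ) - 1 - i else 0) + MAJ v =
      n * des v := by
    rw [hM, hd, mul_sum, ← sum_add_distrib]
    refine sum_congr rfl fun i _ => ?_
    split_ifs <;> ring
  rw [h, hL]
  rw [← hd]
  linear_combination hA

theorem coding_succ_lt_castSucc_iff (v : Fin (n + 1) → α) (i : Fin n) :
    coding v i.succ < coding v i.castSucc ↔ v i.succ < v i.castSucc := by
  rw [coding_lt_iff]
  have : ¬ i.succ < i.castSucc := not_lt.2 Fin.castSucc_lt_succ.le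
  tauto

theorem des_coding (v : Fin (n + 1) → α) : des (coding v) = des v := by
  simp only [des_eq, coding_succ_lt_castSucc_iff]

theorem MAJ_coding (v : Fin (n + 1) → α) : MAJ (coding v) = MAJ v := by
  simp only [MAJ_eq, coding_succ_lt_castSucc_iff]

theorem coding_perm (σ : Equiv.Perm (Fin n)) : coding σ = σ := by
  refine (eq_coding _ _ fun i j => ?_).symm
  constructor
  · exact Or.inl
  · rintro (h | ⟨h, h'⟩)
    · exact h
    · exact absurd (σ.injective h) h'.ne

theorem inverseDescentSet_coding (v : Fin n → α) :
    inverseDescentSet (coding v) = inverseDescentSet v := by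
  simp only [inverseDescentSet, coding_perm]

theorem card_lt_perm (σ : Equiv.Perm (Fin (n + 1))) (i : Fin (n + 1)) :
    #{j | σ j < σ i} = (σ i : ℕ) := by
  rw [← Fin.card_Iio (σ i)]
  exact card_bij (fun j _ => σ j) (by simp) (fun _ _ _ _ h => σ.injective h)
    (fun b hb => ⟨σ.symm b, by simpa using hb, by simp⟩)

theorem coding_zero (v : Fin (n + 1) → α) : #{j | v j < v 0} = (coding v 0 : ℕ) := by
  rw [← card_lt_perm]
  simp [coding_lt_iff]

/-- Coding breaks ties, so single pattern counts may change; their sum does not, by the linear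
relation. -/
theorem STAT_coding (v : Fin (n + 1) → α) : STAT (coding v) = STAT v := by
  have h1 := STAT_add_MAJ v
  have h2 := STAT_add_MAJ (coding v)
  rw [card_lt_perm, des_coding, MAJ_coding] at h2
  rw [coding_zero] at h1
  omega

end Statistics

/-! ### Complementation of bounded functions on blocks. -/

section Symmetry

variable {β : Type*} [LinearOrder β] {N : ℕ}

/-- Sort by `κ`, ties by decreasing position: `κ` is already sorted, so only the order inside each
fiber is reversed. -/
theorem exists_blockReversal {κ : Fin N → β} (hκ : Monotone κ) : ∃ ρ : Equiv.Perm (Fin N),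
    (∀ x, κ (ρ x) = κ x) ∧ ∀ x y, x < y → κ x = κ y → ρ y < ρ x := by
  let k : Fin N → β ×ₗ (Fin N)ᵒᵈ := fun x => toLex (κ x, OrderDual.toDual x)
  have hk : Monotone (k ∘ Tuple.sort k) := Tuple.monotone_sort k
  have hle : ∀ x y, x ≤ y → κ (Tuple.sort k x) < κ (Tuple.sort k y) ∨
      (κ (Tuple.sort k x) = κ (Tuple.sort k y) ∧ Tuple.sort k y ≤ Tuple.sort k x) := by
    intro x y hxy
    exact Prod.Lex.toLex_le_toLex.1 (hk hxy)
  have h1 : κ ∘ Tuple.sort k = κ ∘ (1 : Equiv.Perm (Fin N)) := by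
    refine Tuple.unique_monotone (fun x y hxy => ?_) hκ
    rcases hle x y hxy with h | h
    · exact h.le
    · exact h.1.le
  have h2 : ∀ x, κ (Tuple.sort k x) = κ x := fun x => congrFun h1 x
  refine ⟨Tuple.sort k, h2, fun x y hxy he => ?_⟩
  rcases hle x y hxy.le with h | h
  · rw [h2, h2, he] at h
    exact absurd h (lt_irrefl _)
  · exact h.2.lt_of_ne fun h' => hxy.ne ((Tuple.sort k).injective h').symm

/-- The functions with maximum `M`, first attained at `f`, that are weakly decreasing on the
fibers of `b`. -/
def blockFunctions (b : Fin N → β) (f : Fin N) (M : ℕ) : Finset (Fin N → ℕ) :=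
  (Fintype.piFinset fun _ => range (M + 1)).filter fun g =>
    g f = M ∧ (∀ x < f, g x < M) ∧ ∀ x y, x < y → b x = b y → g y ≤ g x

theorem mem_blockFunctions {b : Fin N → β} {f : Fin N} {M : ℕ} {g : Fin N → ℕ} :
    g ∈ blockFunctions b f M ↔ (∀ x, g x ≤ M) ∧ g f = M ∧ (∀ x < f, g x < M) ∧
      ∀ x y, x < y → b x = b y → g y ≤ g x := by
  simp [blockFunctions]

/-- The complement of `g ∘ ρ` within the range allowed by `blockFunctions`. -/
def blockComplement (f : Fin N) (M : ℕ) (ρ : Equiv.Perm (Fin N)) (g : Fin N → ℕ) :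
    Fin N → ℕ :=
  fun x => if x = f then M else if x < f then M - 1 - g (ρ x) else M - g (ρ x)

/-- `ρ` reverses the blocks into which the fibers of `b` are cut immediately after `f`. -/
structure IsBlockReversal (b : Fin N → β) (f : Fin N) (ρ : Equiv.Perm (Fin N)) : Prop where
  map_block : ∀ x, b (ρ x) = b x
  lt_iff : ∀ x, f < ρ x ↔ f < x
  reverses : ∀ x y, x < y → b x = b y → (f < x ↔ f < y) → ρ y < ρ x

omit [LinearOrder β] in
theorem IsBlockReversal.symm {b : Fin N → β} {f : Fin N} {ρ : Equiv.Perm (Fin N)}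
    (h : IsBlockReversal b f ρ) : IsBlockReversal b f ρ.symm where
  map_block x := by rw [← h.map_block (ρ.symm x), ρ.apply_symm_apply]
  lt_iff x := by rw [← h.lt_iff (ρ.symm x), ρ.apply_symm_apply]
  reverses x y hxy hb hf := by
    by_contra hn
    have hlt : ρ.symm x < ρ.symm y :=
      (not_lt.1 hn).lt_of_ne fun he => hxy.ne (ρ.symm.injective he)
    have := h.reverses _ _ hlt
      (by rw [← h.map_block (ρ.symm x), ← h.map_block (ρ.symm y)]; simpa using hb)
      (by rw [← h.lt_iff (ρ.symm x), ← h.lt_iff (ρ.symm y)]; simpa using hf)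
    simp only [Equiv.apply_symm_apply] at this
    exact hxy.asymm this

theorem exists_isBlockReversal {b : Fin N → β} (hb : Monotone b) (f : Fin N) :
    ∃ ρ, IsBlockReversal b f ρ := by
  let κ : Fin N → β ×ₗ Bool := fun x => toLex (b x, decide (f < x))
  have hκ : Monotone κ := by
    intro x y hxy
    refine Prod.Lex.toLex_le_toLex.2 ?_
    rcases (hb hxy).lt_or_eq with h | h
    · exact Or.inl h
    · exact Or.inr ⟨h, Bool.le_iff_imp.2 (by simpa using fun h => lt_of_lt_of_le h hxy)⟩
  obtain ⟨ρ, h1, h2⟩ := exists_blockReversal hκ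
  have h3 : ∀ x y, κ x = κ y ↔ b x = b y ∧ (f < x ↔ f < y) := by
    intro x y
    simp [κ, Prod.ext_iff]
  exact ⟨ρ, fun x => ((h3 _ _).1 (h1 x)).1, fun x => ((h3 _ _).1 (h1 x)).2,
    fun x y hxy hb hf => h2 x y hxy ((h3 _ _).2 ⟨hb, hf⟩)⟩

variable {b : Fin N → β} {f : Fin N} {M : ℕ} {ρ : Equiv.Perm (Fin N)}

theorem IsBlockReversal.apply_lt (h : IsBlockReversal b f ρ) (hb : Monotone b)
    (hf : ∀ x < f, b x ≠ b f) {x : Fin N} (hx : x < f) : ρ x < f := by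
  have h1 : b (ρ x) < b f := by
    rw [h.map_block]
    exact (hb hx.le).lt_of_ne (hf x hx)
  by_contra hn
  exact absurd (hb (not_lt.1 hn)) (not_le.2 h1)

-- Here `f` is the first element of its block and the cut falls just after it, so its piece is a
-- singleton.
omit [LinearOrder β] in
theorem IsBlockReversal.apply_self (h : IsBlockReversal b f ρ)
    (hf : ∀ x < f, b x ≠ b f) : ρ f = f := by
  rcases lt_trichotomy (ρ f) f with h1 | h1 | h1
  · exact absurd (h.map_block f) (hf _ h1)
  · exact h1
  · exact absurd ((h.lt_iff f).1 h1) (lt_irrefl _)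

/-- Complementing values and reversing positions each turn decreasing into increasing, so together
they preserve the block condition. Before `f` the values range over `0, …, M - 1`, after it over `0,
…, M`. -/
theorem blockComplement_mem (h : IsBlockReversal b f ρ) (hb : Monotone b)
    (hf : ∀ x < f, b x ≠ b f) {g : Fin N → ℕ} (hg : g ∈ blockFunctions b f M) :
    blockComplement f M ρ g ∈ blockFunctions b f M := by
  rw [mem_blockFunctions] at hg ⊢
  obtain ⟨h1, h2, h3, h4⟩ := hg
  refine ⟨fun x => ?_, ?_, fun x hx => ?_, fun x y hxy hbxy => ?_⟩
  · unfold blockComplement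
    split_ifs <;> omega
  · simp [blockComplement]
  · have := h3 x hx
    simp only [blockComplement, hx.ne, hx, if_true, if_false]
    omega
  · by_cases hx : x = f
    · simp only [blockComplement, hx, if_true]
      split_ifs <;> omega
    · rcases lt_or_gt_of_ne hx with hxf | hxf
      · have hyf : y < f := by
          by_contra hn
          refine hf x hxf (le_antisymm (hb hxf.le) ?_)
          rw [hbxy]
          exact hb (not_lt.1 hn)
        have hr := h.reverses x y hxy hbxy (iff_of_false hxf.not_gt hyf.not_gt)
        have := h4 _ _ hr (by rw [h.map_block, h.map_block, hbxy])
        simp only [blockComplement, hxf.ne, hxf, hyf.ne, hyf, if_true, if_false]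
        omega
      · have hyf := hxf.trans hxy
        have hr := h.reverses x y hxy hbxy (iff_of_true hxf hyf)
        have := h4 _ _ hr (by rw [h.map_block, h.map_block, hbxy])
        simp only [blockComplement, hxf.ne', hxf.not_gt, hyf.ne', hyf.not_gt, if_false]
        omega

theorem blockComplement_blockComplement (h : IsBlockReversal b f ρ) (hb : Monotone b)
    (hf : ∀ x < f, b x ≠ b f) {g : Fin N → ℕ} (hg : g ∈ blockFunctions b f M) :
    blockComplement f M ρ.symm (blockComplement f M ρ g) = g := by
  obtain ⟨h1, h2, h3, h4⟩ := mem_blockFunctions.1 hg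
  funext x
  rcases lt_trichotomy x f with hx | rfl | hx
  · have hr := h.symm.apply_lt hb hf hx
    have := h3 x hx
    simp only [blockComplement, hx.ne, hx, hr, hr.ne, if_true, if_false, ρ.apply_symm_apply]
    omega
  · simp [blockComplement, h2]
  · have hr := (h.symm.lt_iff x).2 hx
    have := h1 x
    simp only [blockComplement, hx.ne', hx.not_gt, hr.ne', hr.not_gt, if_false,
      ρ.apply_symm_apply]
    omega

/-- The `- f` comes from the `f` positions complemented in `M - 1`; the extra `M` comes from `f`
itself, whose value stays `M` instead of becoming `0`. -/
theorem sum_blockComplement (h : IsBlockReversal b f ρ) (hb : Monotone b)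
    (hf : ∀ x < f, b x ≠ b f) {g : Fin N → ℕ} (hg : g ∈ blockFunctions b f M) :
    ((∑ x, blockComplement f M ρ g x : ℕ) : ℤ) = (N + 1) * M - f - (∑ x, g x : ℕ) := by
  obtain ⟨h1, h2, h3, h4⟩ := mem_blockFunctions.1 hg
  have hx : ∀ x, (blockComplement f M ρ g x : ℤ) =
      M - g (ρ x) - (if x < f then 1 else 0) + if x = f then (M : ℤ) else 0 := by
    intro x
    rcases lt_trichotomy x f with hx | rfl | hx
    · have := h3 _ (h.apply_lt hb hf hx)
      simp only [blockComplement, hx.ne, hx, if_true, if_false]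
      omega
    · simp [blockComplement, h.apply_self hf, h2]
    · have := h1 (ρ x)
      simp only [blockComplement, hx.ne', hx.not_gt, if_false]
      omega
  have hcard : (univ.filter fun x => x < f) = Iio f := by ext; simp
  push_cast
  simp only [hx, sum_add_distrib, sum_sub_distrib, sum_const, card_univ, Fintype.card_fin,
    sum_ite_eq', mem_univ, if_true, ← sum_filter]
  rw [hcard, Equiv.sum_comp ρ fun x => (g x : ℤ)]
  simp
  ring

/-- The generating function of `blockFunctions` by sum. -/
noncomputable def blockGF (b : Fin N → β) (f : Fin N) (M : ℕ) : LaurentPolynomial ℤ :=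
  ∑ g ∈ blockFunctions b f M, T (∑ x, g x : ℕ)

theorem blockGF_symm (hb : Monotone b) (f : Fin N) (M : ℕ) :
    blockGF b f M = T ((N + 1) * M - f) * invert (blockGF b f M) := by
  by_cases hf : ∀ x < f, b x ≠ b f
  · obtain ⟨ρ, h⟩ := exists_isBlockReversal hb f
    rw [blockGF, map_sum, mul_sum]
    refine sum_nbij' (blockComplement f M ρ) (blockComplement f M ρ.symm) ?_ ?_ ?_ ?_ ?_
    · exact fun g hg => blockComplement_mem h hb hf hg
    · exact fun g hg => blockComplement_mem h.symm hb hf hg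
    · exact fun g hg => blockComplement_blockComplement h hb hf hg
    · exact fun g hg => blockComplement_blockComplement h.symm hb hf hg
    · intro g hg
      rw [sum_blockComplement h hb hf hg, invert_T, ← T_add]
      congr 1
      ring
  -- If `x < f` lies in the block of `f`, then `g x ≥ g f = M` contradicts `g x < M`, so both sides
  -- vanish.
  · push Not at hf
    obtain ⟨x, hx, hbx⟩ := hf
    have : blockFunctions b f M = ∅ := by
      refine eq_empty_of_forall_notMem fun g hg => ?_
      obtain ⟨-, h2, h3, h4⟩ := mem_blockFunctions.1 hg
      have := h3 x hx
      have := h4 x f hx hbx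
      omega
    simp [blockGF, this]

end Symmetry

/-! ### Sorting a function into a permutation and a partition. -/

section Decomposition

variable {n : ℕ}

/-- The number of descents of `v` at or after the position `x`. -/
def descentsFrom {α : Type*} [LinearOrder α] (v : Fin (n + 1) → α) (x : Fin (n + 1)) : ℕ :=
  #{i : Fin n | v i.succ < v i.castSucc ∧ x ≤ i.castSucc}

section DescentsFrom

variable {α : Type*} [LinearOrder α] (v : Fin (n + 1) → α)

theorem descentsFrom_zero : descentsFrom v 0 = des v := by
  simp [descentsFrom, des_eq]

theorem descentsFrom_last : descentsFrom v (Fin.last n) = 0 := by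
  rw [descentsFrom, card_eq_zero, filter_eq_empty_iff]
  rintro i - ⟨-, h⟩
  exact absurd (Fin.castSucc_lt_last i) (not_lt.2 h)

theorem descentsFrom_castSucc (i : Fin n) : descentsFrom v i.castSucc =
    descentsFrom v i.succ + if v i.succ < v i.castSucc then 1 else 0 := by
  have h : ∀ j : Fin n, i.castSucc ≤ j.castSucc ↔ i.succ ≤ j.castSucc ∨ j = i := by
    intro j
    simp only [Fin.le_def, Fin.val_castSucc, Fin.val_succ, Fin.ext_iff]
    omega
  simp only [descentsFrom, h]
  split_ifs with hi
  · rw [← card_insert_of_notMem (a := i)]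
    · congr 1
      ext j
      simp only [mem_filter, mem_univ, true_and, mem_insert]
      by_cases hj : j = i
      · simp [hj, hi]
      · simp [hj]
    · simp
  · rw [add_zero]
    congr 1
    ext j
    simp only [mem_filter, mem_univ, true_and]
    by_cases hj : j = i
    · simp [hj, hi]
    · simp [hj]

/-- A descent `i`, counted from 1, is seen from exactly `i` positions. -/
theorem sum_descentsFrom : ∑ x, descentsFrom v x = MAJ v := by
  have h : ∀ x : Fin (n + 1), descentsFrom v x =
      ∑ i : Fin n with v i.succ < v i.castSucc, if x ≤ i.castSucc then 1 else 0 := by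
    intro x
    rw [descentsFrom, ← filter_filter, card_filter]
  simp only [h, MAJ_eq]
  rw [sum_comm]
  refine sum_congr rfl fun i _ => ?_
  rw [← card_filter]
  have : (univ.filter fun x => x ≤ i.castSucc) = Iic i.castSucc := by ext; simp
  rw [this, Fin.card_Iic, Fin.val_castSucc]

end DescentsFrom

/-- Coding for the dual order lists positions by decreasing value, ties from left to right; hence
values must drop strictly at the descents of `σ`. -/
theorem coding_toDual_eq_iff (g : Fin (n + 1) → ℕ) (σ : Equiv.Perm (Fin (n + 1))) :
    coding (OrderDual.toDual ∘ g) = σ.symm ↔ ∀ i : Fin n,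
      g (σ i.succ) + (if σ i.succ < σ i.castSucc then 1 else 0) ≤ g (σ i.castSucc) := by
  constructor
  · intro h i
    have := coding_lt_iff (OrderDual.toDual ∘ g) (σ i.castSucc) (σ i.succ)
    rw [h] at this
    have := this.1 (by simp)
    simp only [Function.comp_apply, OrderDual.toDual_lt_toDual, OrderDual.toDual_inj] at this
    split_ifs with hd
    · rcases this with h | h
      · exact h
      · exact absurd hd h.2.not_gt
    · omega
  · intro h
    symm
    have hs : StrictMono fun i => (toLex (OrderDual.toDual (g (σ i)), σ i) : ℕᵒᵈ ×ₗ Fin (n + 1)) := by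
      refine Fin.strictMono_iff_lt_succ.2 fun i => Prod.Lex.toLex_lt_toLex.2 ?_
      have := h i
      simp only [OrderDual.toDual_lt_toDual, OrderDual.toDual_inj]
      split_ifs at this with hd
      · exact Or.inl (by omega)
      · have hne : σ i.castSucc ≠ σ i.succ := fun he =>
          (Fin.castSucc_lt_succ (i := i)).ne (σ.injective he)
        have := (not_lt.1 hd).lt_of_ne hne
        rcases (show g (σ i.succ) ≤ g (σ i.castSucc) by omega).lt_or_eq with h' | h'
        · exact Or.inl h'
        · exact Or.inr ⟨h'.symm, this⟩
    refine eq_coding _ _ fun x y => ?_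
    rw [← hs.lt_iff_lt, Prod.Lex.toLex_lt_toLex]
    simp

/-- The letters of each fiber of `b` occur in `σ` in increasing order. -/
abbrev IsCompatible {β : Type*} {N : ℕ} (b : Fin N → β) (σ : Equiv.Perm (Fin N)) : Prop :=
  ∀ x y, x < y → b x = b y → σ.symm x < σ.symm y

/-- The permutations compatible with `b` that have first letter `f`. -/
def readings {β : Type*} [LinearOrder β] (b : Fin (n + 1) → β) (f : Fin (n + 1)) :
    Finset (Equiv.Perm (Fin (n + 1))) :=
  {σ | σ 0 = f ∧ IsCompatible b σ}

variable {β : Type*} [LinearOrder β] {b : Fin (n + 1) → β} {f : Fin (n + 1)} {M : ℕ}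

theorem coding_symm_mem_readings {g : Fin (n + 1) → ℕ} (hg : g ∈ blockFunctions b f M) :
    (coding (OrderDual.toDual ∘ g)).symm ∈ readings b f := by
  obtain ⟨h1, h2, h3, h4⟩ := mem_blockFunctions.1 hg
  have hc := coding_lt_iff (OrderDual.toDual ∘ g)
  simp only [Function.comp_apply, OrderDual.toDual_lt_toDual, OrderDual.toDual_inj] at hc
  simp only [readings, mem_filter, mem_univ, true_and]
  constructor
  · rw [Equiv.symm_apply_eq]
    by_contra hne
    obtain ⟨x, hx⟩ := (coding (OrderDual.toDual ∘ g)).surjective 0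
    have hlt : coding (OrderDual.toDual ∘ g) x < coding (OrderDual.toDual ∘ g) f := by
      rw [hx]
      exact Fin.pos_of_ne_zero (Ne.symm hne)
    rcases (hc x f).1 hlt with h | h
    · have := h1 x
      omega
    · have := h3 x h.2
      omega
  · intro x y hxy hb
    rw [Equiv.symm_symm, hc]
    rcases (h4 x y hxy hb).lt_or_eq with h | h
    · exact Or.inl h
    · exact Or.inr ⟨h.symm, hxy⟩

theorem mem_blockFunctions_of_coding {g : Fin (n + 1) → ℕ} {σ : Equiv.Perm (Fin (n + 1))}
    (hσ : σ ∈ readings b f) (hg : coding (OrderDual.toDual ∘ g) = σ.symm) (hM : g f = M) :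
    g ∈ blockFunctions b f M := by
  simp only [readings, mem_filter, mem_univ, true_and] at hσ
  obtain ⟨rfl, hb⟩ := hσ
  have hc := coding_lt_iff (OrderDual.toDual ∘ g)
  simp only [Function.comp_apply, OrderDual.toDual_lt_toDual, OrderDual.toDual_inj, hg] at hc
  have h0 : ∀ x, x ≠ σ 0 → g x < g (σ 0) ∨ (g (σ 0) = g x ∧ σ 0 < x) := by
    intro x hx
    rw [← hc, Equiv.symm_apply_apply]
    refine Fin.pos_of_ne_zero fun h => hx ?_
    rw [← h, Equiv.apply_symm_apply]
  refine mem_blockFunctions.2 ⟨fun x => ?_, hM, fun x hx => ?_, fun x y hxy he => ?_⟩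
  · by_cases hx : x = σ 0
    · rw [hx, hM]
    · rcases h0 x hx with h | h <;> omega
  · rcases h0 x hx.ne with h | h
    · omega
    · exact absurd hx h.2.not_gt
  · rcases (hc x y).1 (hb x y hxy he) with h | h <;> omega

theorem mem_blockFunctions_const {j : ℕ} {μ : Fin (n + 1) → ℕ} :
    μ ∈ blockFunctions (fun _ => ()) 0 j ↔ μ 0 = j ∧ Antitone μ := by
  rw [mem_blockFunctions]
  constructor
  · rintro ⟨-, h2, -, h4⟩
    refine ⟨h2, fun x y hxy => ?_⟩
    rcases hxy.lt_or_eq with h | h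
    · exact h4 x y h rfl
    · rw [h]
  · rintro ⟨h1, h2⟩
    exact ⟨fun x => h1 ▸ h2 (Fin.zero_le x), h1, fun x hx => absurd hx (Fin.not_lt_zero x),
      fun x y hxy _ => h2 hxy.le⟩

theorem descentsFrom_le {g : Fin (n + 1) → ℕ} {σ : Equiv.Perm (Fin (n + 1))}
    (hg : coding (OrderDual.toDual ∘ g) = σ.symm) (x : Fin (n + 1)) :
    descentsFrom σ x ≤ g (σ x) := by
  rw [coding_toDual_eq_iff] at hg
  induction x using Fin.reverseInduction with
  | last => simp [descentsFrom_last]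
  | cast i ih =>
    rw [descentsFrom_castSucc]
    exact (Nat.add_le_add_right ih _).trans (hg i)

/-- Subtracting `descentsFrom σ` from `g ∘ σ` removes the forced strict drops. It leaves an
arbitrary weakly decreasing sequence with first entry `M - des σ`, and lowers the sum by `MAJ σ`. -/
theorem blockGF_fiber {σ : Equiv.Perm (Fin (n + 1))} (hσ : σ ∈ readings b f) (M : ℕ) :
    (∑ g ∈ blockFunctions b f M with (coding (OrderDual.toDual ∘ g)).symm = σ,
      (T (∑ x, g x : ℕ) : LaurentPolynomial ℤ)) =
    if des σ ≤ M then T (MAJ σ) * blockGF (fun _ : Fin (n + 1) => ()) 0 (M - des σ) else 0 := by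
  have h0 : σ 0 = f := by
    simp only [readings, mem_filter] at hσ
    exact hσ.2.1
  have hcod : ∀ g : Fin (n + 1) → ℕ, (coding (OrderDual.toDual ∘ g)).symm = σ ↔
      coding (OrderDual.toDual ∘ g) = σ.symm := by
    intro g
    exact ⟨fun h => by rw [← h, Equiv.symm_symm], fun h => by rw [h, Equiv.symm_symm]⟩
  simp only [hcod]
  split_ifs with hM
  · rw [blockGF, mul_sum]
    refine sum_nbij' (fun g x => g (σ x) - descentsFrom σ x)
      (fun μ y => μ (σ.symm y) + descentsFrom σ (σ.symm y)) ?_ ?_ ?_ ?_ ?_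
    · intro g hg
      rw [mem_filter] at hg
      obtain ⟨hg, hc⟩ := hg
      have hgM := (mem_blockFunctions.1 hg).2.1
      refine mem_blockFunctions_const.2 ⟨?_, Fin.antitone_iff_succ_le.2 fun i => ?_⟩
      · simp only [h0, hgM, descentsFrom_zero]
      · have h1 := (coding_toDual_eq_iff g σ).1 hc i
        have h2 := descentsFrom_castSucc σ i
        omega
    · intro μ hμ
      obtain ⟨hμ0, hμ⟩ := mem_blockFunctions_const.1 hμ
      have hc : coding (OrderDual.toDual ∘ fun y => μ (σ.symm y) + descentsFrom σ (σ.symm y)) =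
          σ.symm := by
        rw [coding_toDual_eq_iff]
        intro i
        have h1 := hμ (Fin.castSucc_lt_succ (i := i)).le
        have h2 := descentsFrom_castSucc σ i
        simp only [Equiv.symm_apply_apply]
        omega
      rw [mem_filter]
      refine ⟨mem_blockFunctions_of_coding hσ hc ?_, hc⟩
      simp only [← h0, Equiv.symm_apply_apply, hμ0, descentsFrom_zero]
      omega
    · intro g hg
      rw [mem_filter] at hg
      funext y
      have := descentsFrom_le hg.2 (σ.symm y)
      simp only [Equiv.apply_symm_apply] at this ⊢
      omega
    · intro μ _
      simp
    · intro g hg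
      rw [mem_filter] at hg
      rw [← T_add, ← Equiv.sum_comp σ g, ← sum_descentsFrom, ← Nat.cast_add, ← sum_add_distrib]
      congr 2
      refine sum_congr rfl fun x _ => ?_
      have := descentsFrom_le hg.2 x
      omega
  · refine sum_eq_zero fun g hg => ?_
    rw [mem_filter] at hg
    have h1 := descentsFrom_le hg.2 0
    rw [descentsFrom_zero, h0, (mem_blockFunctions.1 hg.1).2.1] at h1
    exact absurd h1 hM

theorem blockGF_eq_sum_readings (b : Fin (n + 1) → β) (f : Fin (n + 1)) (M : ℕ) :
    blockGF b f M = ∑ σ ∈ readings b f, if des σ ≤ M then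
      T (MAJ σ) * blockGF (fun _ : Fin (n + 1) => ()) 0 (M - des σ) else 0 := by
  rw [blockGF, ← sum_fiberwise_of_maps_to (fun g hg => coding_symm_mem_readings hg)]
  exact sum_congr rfl fun σ hσ => blockGF_fiber hσ M

/-- The generating function of MAJ on the readings with `d` descents. -/
noncomputable def majGF (b : Fin (n + 1) → β) (f : Fin (n + 1)) (d : ℕ) : LaurentPolynomial ℤ :=
  ∑ σ ∈ (readings b f).filter fun σ : Equiv.Perm (Fin (n + 1)) => des σ = d, T (MAJ σ)

theorem blockGF_eq_sum_majGF (b : Fin (n + 1) → β) (f : Fin (n + 1)) (M : ℕ) :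
    blockGF b f M = ∑ d ∈ range (M + 1),
      majGF b f d * blockGF (fun _ : Fin (n + 1) => ()) 0 (M - d) := by
  rw [blockGF_eq_sum_readings, ← sum_filter]
  rw [← sum_fiberwise_of_maps_to (t := range (M + 1)) 
    (g := fun σ : Equiv.Perm (Fin (n + 1)) => des σ)]
  · refine sum_congr rfl fun d hd => ?_
    rw [majGF, sum_mul, filter_filter]
    refine sum_congr ?_ ?_
    · ext σ
      simp only [mem_filter, mem_range] at hd ⊢
      constructor
      · rintro ⟨h1, h2, h3⟩
        exact ⟨h1, h3⟩
      · rintro ⟨h1, h3⟩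
        exact ⟨h1, by omega, h3⟩
    · intro σ hσ
      rw [(mem_filter.1 hσ).2]
  · intro σ hσ
    simpa [Nat.lt_succ_iff] using (mem_filter.1 hσ).2

theorem blockGF_const_zero : blockGF (fun _ : Fin (n + 1) => ()) 0 0 = 1 := by
  have : blockFunctions (fun _ : Fin (n + 1) => ()) 0 0 = {0} := by
    ext μ
    rw [mem_blockFunctions_const, mem_singleton]
    constructor
    · rintro ⟨h1, h2⟩
      funext x
      exact Nat.le_zero.1 (h1 ▸ h2 (Fin.zero_le x))
    · rintro rfl
      exact ⟨rfl, antitone_const⟩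
  rw [blockGF, this]
  simp

/-- The decomposition is triangular: the top term is `majGF b f M` times 1. The whole sum and all
lower terms have the symmetry, so the top term has it too. -/
theorem majGF_symm (hb : Monotone b) (f : Fin (n + 1)) (d : ℕ) :
    majGF b f d = T ((n + 2) * d - f) * invert (majGF b f d) := by
  induction d using Nat.strong_induction_on with
  | _ M ih =>
    have h := blockGF_symm hb f M
    rw [blockGF_eq_sum_majGF, map_sum, mul_sum, sum_range_succ, sum_range_succ, Nat.sub_self,
      blockGF_const_zero] at h
    have he : ∀ d ∈ range M, majGF b f d * blockGF (fun _ : Fin (n + 1) => ()) 0 (M - d) =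
        T (((n + 1 : ℕ) + 1) * M - f) *
          invert (majGF b f d * blockGF (fun _ : Fin (n + 1) => ()) 0 (M - d)) := by
      intro d hd
      have hd := mem_range.1 hd
      have hP := blockGF_symm (b := fun _ : Fin (n + 1) => ()) monotone_const 0 (M - d)
      -- The shifts `(n + 2) d - f` and `(n + 2) (M - d)` of the two factors add up to one that is
      -- independent of `d`.
      conv_lhs => rw [ih d hd, hP]
      rw [map_mul, mul_mul_mul_comm, ← T_add]
      congr 2
      push_cast [Nat.cast_sub hd.le]
      simp
      ring
    rw [sum_congr rfl he, mul_one] at h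
    convert add_left_cancel h using 4
    push_cast
    ring

end Decomposition

/-! ### Möbius inversion over inverse descent sets. -/

section InverseDescents

variable {n : ℕ}

theorem mem_inverseDescentSet {N : ℕ} {σ : Equiv.Perm (Fin N)} {x y : Fin N}
    (hxy : (y : ℕ) = x + 1) : (y : ℕ) ∈ inverseDescentSet σ ↔ σ.symm y < σ.symm x := by
  simp only [inverseDescentSet, coding_perm, mem_image, mem_filter, mem_univ, true_and]
  constructor
  · rintro ⟨i, ⟨j, hj, he⟩, hi⟩
    have h1 : σ i = x := Fin.ext (by omega)
    have h2 : σ j = y := Fin.ext (by omega)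
    rwa [← h1, ← h2, Equiv.symm_apply_apply, Equiv.symm_apply_apply]
  · intro h
    exact ⟨σ.symm x, ⟨σ.symm y, h, by simpa using hxy⟩, by simpa using hxy.symm⟩

theorem exists_of_mem_inverseDescentSet {N : ℕ} {σ : Equiv.Perm (Fin N)} {t : ℕ}
    (ht : t ∈ inverseDescentSet σ) : ∃ x y : Fin N, (y : ℕ) = x + 1 ∧ t = y := by
  simp only [inverseDescentSet, coding_perm, mem_image, mem_filter, mem_univ, true_and] at ht
  obtain ⟨i, ⟨j, hj, he⟩, hi⟩ := ht
  exact ⟨σ i, σ j, he, by omega⟩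

/-- Fibers of a monotone `b` are intervals, so consecutive values suffice. Thus compatibility
depends on `σ` only through its inverse descent set. -/
theorem isCompatible_iff {β : Type*} [LinearOrder β] {N : ℕ} {b : Fin N → β} (hb : Monotone b)
    (σ : Equiv.Perm (Fin N)) : IsCompatible b σ ↔
      ∀ x y : Fin N, (y : ℕ) = x + 1 → b x = b y → (y : ℕ) ∉ inverseDescentSet σ := by
  constructor
  · intro h x y hxy he
    rw [mem_inverseDescentSet hxy]
    exact (h x y (by rw [Fin.lt_def]; omega) he).not_gt
  · intro h
    have key : ∀ k (x y : Fin N), (y : ℕ) = x + (k + 1) → b x = b y → σ.symm x < σ.symm y := by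
      have hstep : ∀ x y : Fin N, (y : ℕ) = x + 1 → b x = b y → σ.symm x < σ.symm y := by
        intro x y hxy he
        have := h x y hxy he
        rw [mem_inverseDescentSet hxy, not_lt] at this
        refine this.lt_of_ne fun h' => ?_
        have := σ.symm.injective h'
        rw [this] at hxy
        omega
      intro k
      induction k with
      | zero => exact hstep
      | succ k ih =>
        intro x y hxy he
        have hz : (x : ℕ) + (k + 1) < N := by omega
        have h1 : b x ≤ b ⟨x + (k + 1), hz⟩ := hb (by rw [Fin.le_def]; simp)
        have h2 : b ⟨x + (k + 1), hz⟩ ≤ b y := hb (by rw [Fin.le_def]; simp; omega)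
        have h3 : b x = b ⟨x + (k + 1), hz⟩ := le_antisymm h1 (he ▸ h2)
        exact (ih x ⟨x + (k + 1), hz⟩ rfl h3).trans
          (hstep ⟨x + (k + 1), hz⟩ y (by simp; omega) (h3 ▸ he))
    intro x y hxy
    exact key (y - x - 1) x y (by rw [Fin.lt_def] at hxy; omega)

/-- The index of the block containing `x` when `{0, …, N - 1}` is cut before every element
of `S`. -/
def cutLabel {N : ℕ} (S : Finset ℕ) (x : Fin N) : ℕ := #{t ∈ S | t ≤ (x : ℕ)}

theorem cutLabel_mono {N : ℕ} (S : Finset ℕ) : Monotone (cutLabel S : Fin N → ℕ) := by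
  intro x y hxy
  refine card_le_card fun t ht => ?_
  rw [mem_filter] at ht ⊢
  exact ⟨ht.1, ht.2.trans hxy⟩

theorem cutLabel_eq_iff {N : ℕ} (S : Finset ℕ) {x y : Fin N} (hxy : (y : ℕ) = x + 1) :
    cutLabel S x = cutLabel S y ↔ (y : ℕ) ∉ S := by
  have hsub : (S.filter fun t => t ≤ (x : ℕ)) ⊆ S.filter fun t => t ≤ (y : ℕ) := by
    intro t ht
    rw [mem_filter] at ht ⊢
    exact ⟨ht.1, by omega⟩
  constructor
  · intro h hy
    have := eq_of_subset_of_card_le hsub h.ge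
    have hmem : (y : ℕ) ∈ S.filter fun t => t ≤ (x : ℕ) := by
      rw [this]
      exact mem_filter.2 ⟨hy, le_rfl⟩
    have := (mem_filter.1 hmem).2
    omega
  · intro hy
    refine congrArg card (hsub.antisymm fun t ht => ?_)
    rw [mem_filter] at ht ⊢
    refine ⟨ht.1, ?_⟩
    have : t ≠ y := fun h => hy (h ▸ ht.1)
    omega

theorem isCompatible_cutLabel {N : ℕ} (S : Finset ℕ) (σ : Equiv.Perm (Fin N)) :
    IsCompatible (cutLabel S) σ ↔ inverseDescentSet σ ⊆ S := by
  rw [isCompatible_iff (cutLabel_mono S)]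
  constructor
  · intro h t ht
    obtain ⟨x, y, hxy, rfl⟩ := exists_of_mem_inverseDescentSet ht
    by_contra hS
    exact h x y hxy ((cutLabel_eq_iff S hxy).2 hS) ht
  · intro h x y hxy he ht
    exact (cutLabel_eq_iff S hxy).1 he (h ht)

theorem eq_of_sum_powerset_eq {ι A : Type*} [DecidableEq ι] [AddCommGroup A]
    {u v : Finset ι → A} (h : ∀ S : Finset ι, ∑ I ∈ S.powerset, u I = ∑ I ∈ S.powerset, v I)
    (S : Finset ι) : u S = v S := by
  induction S using Finset.strongInduction with
  | H S ih =>
    have h1 := h S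
    rw [← add_sum_erase _ _ (mem_powerset_self S), ← add_sum_erase _ v (mem_powerset_self S),
      sum_congr rfl fun I hI => ih I ?_] at h1
    · exact add_right_cancel h1
    · rw [mem_erase, mem_powerset] at hI
      exact hI.2.ssubset_of_ne hI.1

/-- The generating function of MAJ on the permutations with first letter `f`, `d` descents and
inverse descent set `I`. -/
noncomputable def inverseDescentGF (f : Fin (n + 1)) (d : ℕ) (I : Finset ℕ) :
    LaurentPolynomial ℤ :=
  ∑ σ ∈ univ.filter fun σ : Equiv.Perm (Fin (n + 1)) =>
    (σ 0 = f ∧ des σ = d) ∧ inverseDescentSet σ = I, T (MAJ σ)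

theorem sum_inverseDescentGF (f : Fin (n + 1)) (d : ℕ) (S : Finset ℕ) :
    ∑ I ∈ S.powerset, inverseDescentGF f d I = majGF (cutLabel S) f d := by
  have h : ((readings (cutLabel S) f).filter fun σ : Equiv.Perm (Fin (n + 1)) => des σ = d) =
      univ.filter fun σ : Equiv.Perm (Fin (n + 1)) =>
        (σ 0 = f ∧ des σ = d) ∧ inverseDescentSet σ ⊆ S := by
    ext σ
    simp only [readings, mem_filter, mem_univ, true_and, isCompatible_cutLabel]
    tauto
  rw [majGF, h, ← filter_filter, ← sum_fiberwise_of_maps_to (t := S.powerset)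
    (g := fun σ : Equiv.Perm (Fin (n + 1)) => inverseDescentSet σ)]
  · refine sum_congr rfl fun I hI => ?_
    rw [inverseDescentGF]
    refine sum_congr ?_ fun _ _ => rfl
    ext σ
    simp only [mem_filter, mem_univ, true_and, mem_powerset] at hI ⊢
    constructor
    · rintro ⟨h1, rfl⟩
      exact ⟨⟨h1, hI⟩, rfl⟩
    · rintro ⟨⟨h1, -⟩, h2⟩
      exact ⟨h1, h2⟩
  · intro σ hσ
    exact mem_powerset.2 (mem_filter.1 hσ).2

/-- The reflection is additive and does not involve `S`, so it passes from the sums over subsets of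
`S` to the single terms. -/
theorem inverseDescentGF_symm (f : Fin (n + 1)) (d : ℕ) (I : Finset ℕ) :
    inverseDescentGF f d I = T ((n + 2) * d - f) * invert (inverseDescentGF f d I) := by
  refine eq_of_sum_powerset_eq (u := inverseDescentGF f d)
    (v := fun I => T ((n + 2) * d - f) * invert (inverseDescentGF f d I)) (fun S => ?_) I
  rw [← mul_sum, ← map_sum, sum_inverseDescentGF]
  exact majGF_symm (cutLabel_mono S) f d

theorem coeff_sum_T {ι : Type*} (s : Finset ι) (u : ι → ℤ) (m : ℤ) :
    (∑ i ∈ s, (T (u i) : LaurentPolynomial ℤ)).coeff m = #{i ∈ s | u i = m} := by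
  rw [AddMonoidAlgebra.coeff_sum, Finsupp.finsetSum_apply, card_filter]
  push_cast
  refine sum_congr rfl fun i _ => ?_
  rw [T, AddMonoidAlgebra.coeff_single, Finsupp.single_apply]

theorem STAT_perm (σ : Equiv.Perm (Fin (n + 1))) :
    (STAT σ : ℤ) = (n + 2) * des σ - σ 0 + -MAJ σ := by
  have := STAT_add_MAJ σ
  rw [card_lt_perm] at this
  zify at this
  linarith

theorem card_MAJ_eq_card_STAT (f : Fin (n + 1)) (d : ℕ) (I : Finset ℕ) (m : ℕ) :
    #{σ : Equiv.Perm (Fin (n + 1)) |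
      ((σ 0 = f ∧ des σ = d) ∧ inverseDescentSet σ = I) ∧ MAJ σ = m} =
    #{σ : Equiv.Perm (Fin (n + 1)) |
      ((σ 0 = f ∧ des σ = d) ∧ inverseDescentSet σ = I) ∧ STAT σ = m} := by
  have h := inverseDescentGF_symm f d I
  have h2 : T ((n + 2) * d - f) * invert (inverseDescentGF f d I) =
      ∑ σ ∈ univ.filter fun σ : Equiv.Perm (Fin (n + 1)) =>
        (σ 0 = f ∧ des σ = d) ∧ inverseDescentSet σ = I, T (STAT σ) := by
    rw [inverseDescentGF, map_sum, mul_sum]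
    refine sum_congr rfl fun σ hσ => ?_
    obtain ⟨⟨rfl, rfl⟩, -⟩ := (mem_filter.1 hσ).2
    rw [invert_T, ← T_add, STAT_perm]
  rw [h2, inverseDescentGF] at h
  have hm := congrArg (fun p => p.coeff (m : ℤ)) h
  simp only [coeff_sum_T, filter_filter, Nat.cast_inj] at hm
  exact hm

/-- A bijection on permutations that carries MAJ to STAT and conversely. -/
theorem exists_perm_equiv (n : ℕ) :
    ∃ φ : Equiv.Perm (Equiv.Perm (Fin (n + 1))), ∀ σ, φ σ 0 = σ 0 ∧ des (φ σ) = des σ ∧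
      inverseDescentSet (φ σ) = inverseDescentSet σ ∧ STAT (φ σ) = MAJ σ ∧
      MAJ (φ σ) = STAT σ := by
  let F : Equiv.Perm (Fin (n + 1)) → ((Fin (n + 1) × ℕ) × Finset ℕ) × ℕ :=
    fun σ => (((σ 0, des σ), inverseDescentSet σ), MAJ σ)
  let G : Equiv.Perm (Fin (n + 1)) → ((Fin (n + 1) × ℕ) × Finset ℕ) × ℕ :=
    fun σ => (((σ 0, des σ), inverseDescentSet σ), STAT σ)
  have hcard : ∀ c, Fintype.card {σ // F σ = c} = Fintype.card {σ // G σ = c} := by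
    rintro ⟨⟨⟨f, d⟩, I⟩, m⟩
    rw [Fintype.card_subtype, Fintype.card_subtype]
    simpa only [F, G, Prod.mk.injEq] using card_MAJ_eq_card_STAT f d I m
  -- Arbitrary bijections between the equinumerous fibers of `F` and `G` are glued together.
  refine ⟨Equiv.ofFiberEquiv fun c => Fintype.equivOfCardEq (hcard c), fun σ => ?_⟩
  have h := Equiv.ofFiberEquiv_map (fun c => Fintype.equivOfCardEq (hcard c)) σ
  generalize Equiv.ofFiberEquiv (fun c => Fintype.equivOfCardEq (hcard c)) σ = τ at h
  simp only [F, G, Prod.mk.injEq] at h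
  obtain ⟨⟨⟨h1, h2⟩, h3⟩, h4⟩ := h
  refine ⟨h1, h2, h3, h4, ?_⟩
  -- STAT + MAJ depends only on the first letter and `des`, both preserved, so sending MAJ to STAT
  -- forces the converse.
  have h5 := STAT_perm σ
  have h6 := STAT_perm τ
  rw [h1, h2, h4] at h6
  omega

end InverseDescents

/-! ### Transfer from permutations to words. -/

section Words

variable {α : Type*} [LinearOrder α]

theorem coding_comp {N : ℕ} {w : Fin N → α} (hw : Monotone w) {σ : Equiv.Perm (Fin N)}
    (hσ : IsCompatible w σ) : coding (w ∘ σ) = σ := by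
  refine (eq_coding _ _ fun i j => ?_).symm
  have h1 := hσ (σ i) (σ j)
  have h2 := hσ (σ j) (σ i)
  simp only [Equiv.symm_apply_apply] at h1 h2
  constructor
  · intro h
    rcases (hw h.le).lt_or_eq with h' | h'
    · exact Or.inl h'
    · exact Or.inr ⟨h', h1 h h'⟩
  · rintro (h | ⟨h, h'⟩)
    · exact hw.reflect_lt h
    · rcases lt_trichotomy (σ i) (σ j) with h3 | h3 | h3
      · exact h3
      · exact absurd (σ.injective h3) h'.ne
      · exact absurd (h2 h3 h.symm) h'.not_gt

theorem comp_coding {N : ℕ} {w v : Fin N → α} (hv : v ∈ rearrangementClass w) :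
    (w ∘ Tuple.sort w) ∘ coding v = v := by
  simp only [rearrangementClass, mem_image, mem_univ, true_and] at hv
  obtain ⟨τ, rfl⟩ := hv
  rw [← Tuple.comp_perm_comp_sort_eq_comp_sort (f := w) (σ := τ), coding]
  funext x
  simp

theorem isCompatible_coding {N : ℕ} {w v : Fin N → α} (h : w ∘ coding v = v) :
    IsCompatible w (coding v) := by
  intro x y hxy he
  have h1 : ∀ i, v ((coding v).symm i) = w i := by
    intro i
    rw [← congrFun h ((coding v).symm i)]
    simp
  have := (coding_lt_iff v ((coding v).symm x) ((coding v).symm y)).1 (by simpa using hxy)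
  rw [h1, h1, he] at this
  exact (this.resolve_left (lt_irrefl _)).2

/-- Coding identifies the rearrangement class with the permutations compatible with the sorted word,
and `φ` is transported through it. -/
theorem exists_swap {n : ℕ} (w : Fin (n + 1) → α) :
    ∃ Φ : (Fin (n + 1) → α) → (Fin (n + 1) → α), Set.InjOn Φ (rearrangementClass w) ∧
      ∀ v ∈ rearrangementClass w, Φ v ∈ rearrangementClass w ∧ des (Φ v) = des v ∧
        inverseDescentSet (Φ v) = inverseDescentSet v ∧ firstLetter (Φ v) = firstLetter v ∧
        STAT (Φ v) = MAJ v ∧ MAJ (Φ v) = STAT v := by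
  obtain ⟨φ, hφ⟩ := exists_perm_equiv n
  have hmono : Monotone (w ∘ Tuple.sort w) := Tuple.monotone_sort w
  have hcod : ∀ v ∈ rearrangementClass w,
      coding ((w ∘ Tuple.sort w) ∘ φ (coding v)) = φ (coding v) := by
    intro v hv
    refine coding_comp hmono ?_
    -- Preservation of the inverse descent set is what keeps `φ` inside the compatible permutations.
    rw [isCompatible_iff hmono, (hφ _).2.2.1, ← isCompatible_iff hmono]
    exact isCompatible_coding (comp_coding hv)
  refine ⟨fun v => (w ∘ Tuple.sort w) ∘ φ (coding v), fun u hu v hv h => ?_, fun v hv => ?_⟩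
  · have h' := congrArg coding h
    simp only [hcod u hu, hcod v hv, EmbeddingLike.apply_eq_iff_eq] at h'
    rw [← comp_coding hu, ← comp_coding hv, h']
  · obtain ⟨h1, h2, h3, h4, h5⟩ := hφ (coding v)
    refine ⟨?_, ?_, ?_, ?_, ?_, ?_⟩
    · exact mem_image.2 ⟨Tuple.sort w * φ (coding v), mem_univ _, rfl⟩
    · rw [← des_coding, hcod v hv, h2, des_coding]
    · rw [← inverseDescentSet_coding, hcod v hv, h3, inverseDescentSet_coding]
    · have h := congrFun (comp_coding hv) 0
      simp only [Function.comp_apply] at h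
      simp [firstLetter, h1, h]
    · rw [← STAT_coding, hcod v hv, h4, MAJ_coding]
    · rw [← MAJ_coding, hcod v hv, h5, STAT_coding]

end Words

end WordStat

theorem mainTheorem2 {α : Type*} [LinearOrder α] {n : ℕ} (w : Fin n → α) :
    WordStat.EquidistributedOn (WordStat.rearrangementClass w)
      (fun v => (WordStat.des v, WordStat.inverseDescentSet v, WordStat.firstLetter v,
        WordStat.MAJ v, WordStat.STAT v))
      (fun v => (WordStat.des v, WordStat.inverseDescentSet v, WordStat.firstLetter v,
        WordStat.STAT v, WordStat.MAJ v)) := by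
  cases n with
  | zero =>
    have h : ∀ v : Fin 0 → α, WordStat.MAJ v = WordStat.STAT v := by
      intro v
      simp [WordStat.MAJ, WordStat.descentSet, WordStat.STAT, WordStat.occurrences]
    intro c
    simp only [h]
  | succ n =>
    obtain ⟨Φ, hinj, hΦ⟩ := WordStat.exists_swap w
    rintro ⟨d, I, a, m, s⟩
    -- `Φ` exchanges MAJ and STAT, so the same injection gives both inequalities.
    refine le_antisymm (Finset.card_le_card_of_injOn Φ (fun v hv => ?_) ?_)
      (Finset.card_le_card_of_injOn Φ (fun v hv => ?_) ?_)
    · simp only [Finset.coe_filter, Set.mem_ofPred_eq, Prod.mk.injEq] at hv ⊢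
      obtain ⟨h0, h1, h2, h3, h4, h5⟩ := hΦ v hv.1
      rw [h1, h2, h3, h4, h5]
      exact ⟨h0, hv.2⟩
    · exact hinj.mono fun v hv => (Finset.mem_filter.1 hv).1
    · simp only [Finset.coe_filter, Set.mem_ofPred_eq, Prod.mk.injEq] at hv ⊢
      obtain ⟨h0, h1, h2, h3, h4, h5⟩ := hΦ v hv.1
      rw [h1, h2, h3, h4, h5]
      exact ⟨h0, hv.2⟩
    · exact hinj.mono fun v hv => (Finset.mem_filter.1 hv).1
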